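/- There exist universal constants $c>0$ and $A>0$ such that the following holds. Let $G=(V,E,J)$ be a weighted graph with countable vertex set $V$, countable edge set $E$ (parallel edges and loops are allowed, and no local finiteness is assumed) and edge weights $J(e)\in[0,\infty)$. Let $\Lambda\subseteq V$ be finite and non-empty, and let $\beta\ge 0$. Let $\omega\in\{0,1\}^E$ be Bernoulli-$\beta$ bond percolation on $G$, in which each edge $e$ is open independently with probability $1-e^{-\beta J(e)}$, and write $\mathbf P_\beta,\mathbf E_\beta$ for its law and expectation. Let $\mathscr C$ be the random partition of $\Lambda$ into the non-empty sets of the form $C\cap\Lambda$, where $C$ is a cluster of $\omega$, that is, a connected component of the graph formed by $V$ and the open edges (connections may leave $\Lambda$). Set $\|\mathscr C\|_p=\bigl(\sum_{B\in\mathscr C}|B|^p\bigr)^{1/p}$ for $1\le p<\infty$ and $\|\mathscr C\|_\infty=\max_{B\in\mathscr C}|B|$. Then $\|\mathscr C\|_p$ is an integrable random variable for every $1\le p\le\infty$, and $$\mathbf P_\beta\bigl(\|\mathscr C\|_p\ge \alpha\,\mathbf E_\beta\|\mathscr C\|_p\bigr)\le A e^{-c\alpha}\qquad\text{and}\qquad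 \mathbf P_\beta\bigl(\|\mathscr C\|_p<\varepsilon\,\mathbf E_\beta\|\mathscr C\|_p\bigr)\le A\varepsilon$$ for every $1\le p\le\infty$, $\alpha\ge 1$ and $0<\varepsilon\le 1$. The constants $c$ and $A$ depend on none of $G$, $\Lambda$, $\beta$, $p$, $\alpha$, $\varepsilon$. -/

import Mathlib

open MeasureTheory ProbabilityTheory
open scoped ENNReal NNReal

noncomputable section

/-- The `ℓ^p` norm of a partition `P` of a finite set: `(∑_{B ∈ P} |B|^p)^{1/p}` for `p < ∞`, and
the largest size of a part for `p = ∞`. -/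
def Finpartition.lpNorm {V : Type*} [DecidableEq V] {Λ : Finset V} (P : Finpartition Λ)
    (p : ℝ≥0∞) : ℝ :=
  if p = ∞ then ((P.parts.sup Finset.card : ℕ) : ℝ)
  else (∑ B ∈ P.parts, (B.card : ℝ) ^ p.toReal) ^ (1 / p.toReal)

/-- A weighted graph `(V, E, J)` with vertex type `V` and edge type `E`: every edge has an unordered
pair of endpoints and a weight in `[0, ∞)`. Parallel edges and loops are allowed; no local
finiteness or summability is required. A simple graph `H` with weights is the case
`E = H.edgeSet`, `ends = Subtype.val`. -/
structure WeightedGraph (V E : Type*) where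
  /-- The unordered pair of endpoints of an edge. -/
  ends : E → Sym2 V
  /-- The weight `J e` of an edge. -/
  weight : E → ℝ≥0

namespace WeightedGraph

variable {V E : Type*} [DecidableEq V] (G : WeightedGraph V E)

/-- The probability `1 - exp (-β J(e))` that the edge `e` is open. -/
def openProb (β : ℝ≥0) (e : E) : unitInterval :=
  ⟨1 - Real.exp (-((β : ℝ) * (G.weight e : ℝ))),
    sub_nonneg.2 (Real.exp_le_one_iff.2 (neg_nonpos.2 (by positivity))),
    sub_le_self 1 (Real.exp_pos _).le⟩

/-- The law of Bernoulli-`β` bond percolation on `G`, a measure on `{0,1}^E`: the edges are open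
(`true`) or closed (`false`) independently, and `e` is open with probability
`1 - exp (-β J(e))`. -/
def percolation (β : ℝ≥0) : Measure (E → Bool) :=
  Measure.infinitePi fun e => bernoulliMeasure true false (G.openProb β e)

/-- The graph on `V` in which distinct vertices are adjacent when some open edge joins them. Its
connected components are the clusters of `ω`. -/
def openSubgraph (ω : E → Bool) : SimpleGraph V :=
  SimpleGraph.fromEdgeSet {s | ∃ e, ω e = true ∧ G.ends e = s}

/-- The partition `𝒞(ω, Λ)` of `Λ` into the non-empty sets `C ∩ Λ`, for `C` a cluster of `ω`:
two vertices of `Λ` are in the same part when an open path of the whole graph `G` joins them. -/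
def clusterPartition (ω : E → Bool) (Λ : Finset V) : Finpartition Λ :=
  letI : DecidableRel (G.openSubgraph ω).reachableSetoid.r := Classical.decRel _
  Finpartition.ofSetSetoid (G.openSubgraph ω).reachableSetoid Λ

/-- The parts of `clusterPartition` are exactly the non-empty sets `C ∩ Λ`, for `C` a cluster. -/
theorem mem_parts_clusterPartition (ω : E → Bool) (Λ B : Finset V) :
    B ∈ (G.clusterPartition ω Λ).parts ↔
      B.Nonempty ∧ ∃ C : (G.openSubgraph ω).ConnectedComponent,
        (B : Set V) = C.supp ∩ (Λ : Set V) := by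
  classical
  have key : ∀ v : V, ((Λ.filter fun w => (G.openSubgraph ω).Reachable v w : Finset V) : Set V) =
      ((G.openSubgraph ω).connectedComponentMk v).supp ∩ (Λ : Set V) := by
    intro v
    ext w
    simp only [Finset.coe_filter, Set.mem_ofPred_eq, Set.mem_inter_iff,
      SimpleGraph.ConnectedComponent.mem_supp_iff, SimpleGraph.ConnectedComponent.eq,
      Finset.mem_coe]
    exact ⟨fun h => ⟨h.2.symm, h.1⟩, fun h => ⟨h.2, h.1.symm⟩⟩
  have hparts : B ∈ (G.clusterPartition ω Λ).parts ↔
      ∃ v ∈ Λ, (Λ.filter fun w => (G.openSubgraph ω).Reachable v w) = B := by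
    simp only [clusterPartition, Finpartition.ofSetSetoid, Finset.mem_image]
    constructor
    · rintro ⟨v, hv, h⟩
      exact ⟨v, hv, by rw [← h]; exact Finset.filter_congr fun w _ => Iff.rfl⟩
    · rintro ⟨v, hv, h⟩
      exact ⟨v, hv, by rw [← h]; exact Finset.filter_congr fun w _ => Iff.rfl⟩
  rw [hparts]
  constructor
  · rintro ⟨v, hv, rfl⟩
    exact ⟨⟨v, by simp [hv]⟩, _, key v⟩
  · rintro ⟨⟨v, hv⟩, C, hC⟩
    have hv' : v ∈ C.supp ∩ (Λ : Set V) := hC ▸ Finset.mem_coe.2 hv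
    refine ⟨v, hv'.2, Finset.coe_injective ?_⟩
    rw [key v, hC, SimpleGraph.ConnectedComponent.mem_supp_iff _ _ |>.1 hv'.1]

/-- The random variable `‖𝒞‖_p`, the `ℓ^p` norm of the partition of `Λ` into clusters. -/
def clusterNorm (Λ : Finset V) (p : ℝ≥0∞) (ω : E → Bool) : ℝ :=
  (G.clusterPartition ω Λ).lpNorm p

end WeightedGraph

end

/-! Write X for the cluster norm. Both tails follow from one inequality, P(X ≥ 3kt) ≤ P(X ≥ t)^k for
k ≥ 1. For the upper tail, Markov's inequality gives P(X ≥ e E X) ≤ 1/e, and taking k of order α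
turns this into exponential decay. For the lower tail, put Q = P(X < t); summing the tail over
multiples of 3t gives E X ≤ 3t ∑ (1 - Q)^k, hence Q E X ≤ 3t, and t = ε E X yields Q ≤ 3ε.

The inequality combines a deterministic cut with the van den Berg–Kesten inequality. A cluster that
meets Λ in a vertices contains k edge-disjoint pieces, each connecting at least a/(3k) vertices of Λ
(`exists_cut`, `exists_disjoint_pieces`). The cut uses no bound on degrees, which is why the
constants are universal. The j-th pieces of all clusters together form a configuration whose norm is
at least X/(3k), and these k configurations are disjoint (`exists_disjoint_clusterNorm_le`). So X ≥
3kt forces k disjoint occurrences of the increasing event X ≥ t, which has probability at most P(X ≥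
t)^k (`bernoulliProduct_real_disjointPower_le`). This is done inside finite edge sets, and
continuity from below gives the general case (`percolation_real_clusterNorm_ge_le_pow`). -/

/-! ### Disjoint occurrence and sections of events -/

section DisjointOccurrence

variable {ι : Type*}

/-- The disjoint occurrence of two events: `ω` contains disjoint configurations, one in each. -/
def disjointOccurrence (A B : Set (ι → Bool)) : Set (ι → Bool) :=
  {ω | ∃ a ∈ A, ∃ b ∈ B, Disjoint a b ∧ a ≤ ω ∧ b ≤ ω}

/-- The event that `ω` contains `k` pairwise disjoint configurations from `A`. -/
def disjointPower (A : Set (ι → Bool)) (k : ℕ) : Set (ι → Bool) :=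
  {ω | ∃ T : Fin k → ι → Bool, Pairwise (Function.onFun Disjoint T) ∧ ∀ i, T i ∈ A ∧ T i ≤ ω}

theorem disjointOccurrence_comm (A B : Set (ι → Bool)) :
    disjointOccurrence A B = disjointOccurrence B A := by
  ext ω
  exact ⟨fun ⟨a, ha, b, hb, h, h₁, h₂⟩ => ⟨b, hb, a, ha, h.symm, h₂, h₁⟩,
    fun ⟨a, ha, b, hb, h, h₁, h₂⟩ => ⟨b, hb, a, ha, h.symm, h₂, h₁⟩⟩

theorem disjointOccurrence_mono {A A' B B' : Set (ι → Bool)} (hA : A ⊆ A') (hB : B ⊆ B') :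
    disjointOccurrence A B ⊆ disjointOccurrence A' B' :=
  fun _ ⟨a, ha, b, hb, h⟩ => ⟨a, hA ha, b, hB hb, h⟩

theorem isUpperSet_disjointPower (A : Set (ι → Bool)) (k : ℕ) :
    IsUpperSet (disjointPower A k) :=
  fun _ _ hω ⟨T, hT, h⟩ => ⟨T, hT, fun i => ⟨(h i).1, (h i).2.trans hω⟩⟩

theorem disjointPower_succ_subset (A : Set (ι → Bool)) (k : ℕ) :
    disjointPower A (k + 1) ⊆ disjointOccurrence A (disjointPower A k) := by
  rintro ω ⟨T, hT, h⟩
  refine ⟨T 0, (h 0).1, Finset.univ.sup fun i : Fin k => T i.succ,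
    ⟨fun i => T i.succ, fun i j hij => hT (by simpa using hij),
      fun i => ⟨(h _).1, Finset.le_sup (f := fun i : Fin k => T i.succ) (Finset.mem_univ i)⟩⟩,
    ?_, (h 0).2, Finset.sup_le fun i _ => (h _).2⟩
  exact Finset.disjoint_sup_right.2 fun i _ => hT (Fin.succ_ne_zero i).symm

open Classical in
/-- The configuration `ω` restricted to `F`, and closed elsewhere. -/
noncomputable def restrictConfig (F : Finset ι) (ω : ι → Bool) : ι → Bool :=
  fun i => if i ∈ F then ω i else false

theorem restrictConfig_le (F : Finset ι) (ω : ι → Bool) : restrictConfig F ω ≤ ω := by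
  intro i
  by_cases h : i ∈ F <;> simp [restrictConfig, h]

theorem restrictConfig_le_of_agree {F : Finset ι} {a ω ω' : ι → Bool} (h : a ≤ ω)
    (hω : ∀ i ∈ (F : Set ι), ω i = ω' i) : restrictConfig F a ≤ ω' := by
  intro i
  by_cases hi : i ∈ F
  · simpa [restrictConfig, hi, ← hω i hi] using h i
  · simp [restrictConfig, hi]

theorem restrictConfig_mem_iff {F : Finset ι} {A : Set (ι → Bool)}
    (hA : DependsOn (· ∈ A) (F : Set ι)) (ω : ι → Bool) : restrictConfig F ω ∈ A ↔ ω ∈ A :=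
  iff_of_eq (hA fun i hi => by simp [restrictConfig, Finset.mem_coe.1 hi])

theorem disjoint_restrictConfig {F : Finset ι} {a b : ι → Bool} (h : Disjoint a b) :
    Disjoint (restrictConfig F a) (restrictConfig F b) :=
  h.mono (restrictConfig_le F a) (restrictConfig_le F b)

/-- Closing every coordinate outside F in both witnesses keeps them in their events and keeps them
disjoint. -/
theorem dependsOn_disjointOccurrence {F : Finset ι} {A B : Set (ι → Bool)}
    (hA : DependsOn (· ∈ A) (F : Set ι)) (hB : DependsOn (· ∈ B) (F : Set ι)) :
    DependsOn (· ∈ disjointOccurrence A B) (F : Set ι) := by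
  have key : ∀ x y : ι → Bool, (∀ i ∈ (F : Set ι), x i = y i) →
      x ∈ disjointOccurrence A B → y ∈ disjointOccurrence A B := by
    rintro x y hxy ⟨a, ha, b, hb, hab, hax, hbx⟩
    exact ⟨_, (restrictConfig_mem_iff hA a).2 ha, _, (restrictConfig_mem_iff hB b).2 hb,
      disjoint_restrictConfig hab, restrictConfig_le_of_agree hax hxy,
      restrictConfig_le_of_agree hbx hxy⟩
  exact fun x y hxy => propext ⟨key x y hxy, key y x fun i hi => (hxy i hi).symm⟩

theorem dependsOn_disjointPower {F : Finset ι} {A : Set (ι → Bool)}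
    (hA : DependsOn (· ∈ A) (F : Set ι)) (k : ℕ) :
    DependsOn (· ∈ disjointPower A k) (F : Set ι) := by
  have key : ∀ x y : ι → Bool, (∀ i ∈ (F : Set ι), x i = y i) →
      x ∈ disjointPower A k → y ∈ disjointPower A k := by
    rintro x y hxy ⟨T, hT, h⟩
    exact ⟨fun i => restrictConfig F (T i), fun i j hij => disjoint_restrictConfig (hT hij),
      fun i => ⟨(restrictConfig_mem_iff hA _).2 (h i).1, restrictConfig_le_of_agree (h i).2 hxy⟩⟩
  exact fun x y hxy => propext ⟨key x y hxy, key y x fun i hi => (hxy i hi).symm⟩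

theorem measurableSet_of_dependsOn {F : Finset ι} {A : Set (ι → Bool)}
    (hA : DependsOn (· ∈ A) (F : Set ι)) : MeasurableSet A := by
  have : A = F.restrict ⁻¹' (F.restrict '' A : Set (F → Bool)) := by
    refine (Set.subset_preimage_image _ _).antisymm ?_
    rintro x ⟨y, hy, hxy⟩
    exact (iff_of_eq (hA fun i hi => congrFun hxy ⟨i, hi⟩)).1 hy
  rw [this]
  exact Finset.measurable_restrict F .of_discrete

variable [DecidableEq ι]

/-- The section of the event `A` in which the coordinate `e` is set to `b`. -/
def sectionAt (A : Set (ι → Bool)) (e : ι) (b : Bool) : Set (ι → Bool) :=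
  {ω | Function.update ω e b ∈ A}

theorem dependsOn_sectionAt {F : Finset ι} {e : ι} {A : Set (ι → Bool)}
    (hA : DependsOn (· ∈ A) (insert e F : Finset ι)) (b : Bool) :
    DependsOn (· ∈ sectionAt A e b) (F : Set ι) := by
  intro x y hxy
  refine hA fun i hi => ?_
  by_cases h : i = e
  · subst h; simp
  · rw [Function.update_of_ne h, Function.update_of_ne h]
    exact hxy i (by simpa [h] using hi)

theorem isUpperSet_sectionAt {A : Set (ι → Bool)} (hA : IsUpperSet A) (e : ι) (b : Bool) :
    IsUpperSet (sectionAt A e b) := by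
  intro x y hxy hx
  exact hA (update_le_update_iff.2 ⟨le_rfl, fun i _ => hxy i⟩) hx

theorem sectionAt_false_subset {A : Set (ι → Bool)} (hA : IsUpperSet A) (e : ι) :
    sectionAt A e false ⊆ sectionAt A e true := by
  intro x hx
  exact hA (update_le_update_iff.2 ⟨Bool.false_le _, fun _ _ => le_rfl⟩) hx

/-- When e is closed, neither witness can use it. -/
theorem sectionAt_false_disjointOccurrence_subset (A B : Set (ι → Bool)) (e : ι) :
    sectionAt (disjointOccurrence A B) e false ⊆
      disjointOccurrence (sectionAt A e false) (sectionAt B e false) := by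
  have key : ∀ a x : ι → Bool, a ≤ Function.update x e false →
      Function.update a e false = a ∧ a ≤ x := by
    intro a x h
    have he : a e = false := Bool.eq_false_of_le_false (by simpa using h e)
    refine ⟨by rw [← he]; exact Function.update_eq_self e a, fun i => ?_⟩
    by_cases hi : i = e
    · subst hi; simp [he]
    · simpa [hi] using h i
  rintro x ⟨a, ha, b, hb, hab, hax, hbx⟩
  obtain ⟨ha', hax'⟩ := key a x hax
  obtain ⟨hb', hbx'⟩ := key b x hbx
  refine ⟨a, ?_, b, ?_, hab, hax', hbx'⟩
  · change Function.update a e false ∈ A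
    rwa [ha']
  · change Function.update b e false ∈ B
    rwa [hb']

/-- Disjoint witnesses cannot both use e, so one of them already lies in the section where e is
closed. -/
theorem sectionAt_true_disjointOccurrence_subset {A B : Set (ι → Bool)} (hA : IsUpperSet A)
    (hB : IsUpperSet B) (e : ι) :
    sectionAt (disjointOccurrence A B) e true ⊆
      disjointOccurrence (sectionAt A e true) (sectionAt B e false) ∪
        disjointOccurrence (sectionAt A e false) (sectionAt B e true) := by
  have key : ∀ {A B : Set (ι → Bool)}, IsUpperSet A → ∀ {a b x : ι → Bool}, a ∈ A → b ∈ B →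
      Disjoint a b → a ≤ Function.update x e true → b ≤ Function.update x e true → b e = false →
      x ∈ disjointOccurrence (sectionAt A e true) (sectionAt B e false) := by
    intro A B hA a b x ha hb hab hax hbx he
    have hupd : Function.update a e false ≤ a :=
      update_le_iff.2 ⟨Bool.false_le _, fun _ _ => le_rfl⟩
    -- Membership in the section ignores the value at e, so a may be closed there; this puts it
    -- below x even if x is closed at e.
    refine ⟨Function.update a e false, ?_, b, ?_, hab.mono_left hupd, ?_, ?_⟩
    · change Function.update (Function.update a e false) e true ∈ A
      rw [Function.update_idem]
      exact hA (le_update_iff.2 ⟨Bool.le_true _, fun _ _ => le_rfl⟩) ha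
    · change Function.update b e false ∈ B
      rw [← he, Function.update_eq_self]
      exact hb
    · refine update_le_iff.2 ⟨Bool.false_le _, fun i hi => ?_⟩
      simpa [hi] using hax i
    · intro i
      by_cases hi : i = e
      · subst hi; simp [he]
      · simpa [hi] using hbx i
  rintro x ⟨a, ha, b, hb, hab, hax, hbx⟩
  by_cases he : b e = false
  · exact Or.inl (key hA ha hb hab hax hbx he)
  · have he' : a e = false := by
      have h := Pi.disjoint_iff.1 hab e
      rw [Bool.not_eq_false] at he
      rw [he, disjoint_iff] at h
      simpa using h
    right
    rw [disjointOccurrence_comm]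
    exact key hB hb ha hab.symm hbx hax he'

end DisjointOccurrence

/-! ### The van den Berg–Kesten inequality -/

section BernoulliProduct

variable {ι : Type*} (q : ι → unitInterval)

/-- The law of independent bits, the `i`-th of which is `true` with probability `q i`. -/
noncomputable abbrev bernoulliProduct : Measure (ι → Bool) :=
  Measure.infinitePi fun i => bernoulliMeasure true false (q i)

theorem bernoulliProduct_real_inter_coord [DecidableEq ι] {F : Finset ι} {e : ι} (he : e ∉ F)
    {A : Set (ι → Bool)} (hA : DependsOn (· ∈ A) (F : Set ι)) (b : Bool) :
    (bernoulliProduct q).real (A ∩ {ω | ω e = b}) =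
      (bernoulliProduct q).real A * (bernoulliMeasure true false (q e)).real {b} := by
  have hind : iIndepFun (fun i (ω : ι → Bool) => ω i) (bernoulliProduct q) :=
    iIndepFun_infinitePi (P := fun i => bernoulliMeasure true false (q i))
      (X := fun _ => id) fun _ => measurable_id
  have h2 := hind.indepFun_finset F {e} (by simpa using he) fun i => measurable_pi_apply i
  have hAeq : A = (fun (a : ι → Bool) (i : F) => a i) ⁻¹' (F.restrict '' A : Set (F → Bool)) := by
    refine (Set.subset_preimage_image _ _).antisymm ?_
    rintro x ⟨y, hy, hxy⟩
    exact (iff_of_eq (hA fun i hi => congrFun hxy ⟨i, hi⟩)).1 hy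
  have hE : {ω : ι → Bool | ω e = b} = (fun (a : ι → Bool) (i : ({e} : Finset ι)) => a i) ⁻¹'
      {x | x ⟨e, by simp⟩ = b} := rfl
  have h3 := h2.measure_inter_preimage_eq_mul _ _
    (MeasurableSet.of_discrete (s := (F.restrict '' A : Set (F → Bool))))
    (MeasurableSet.of_discrete (s := {x : ({e} : Finset ι) → Bool | x ⟨e, by simp⟩ = b}))
  rw [← hAeq, ← hE] at h3
  have h4 : (bernoulliProduct q) {ω : ι → Bool | ω e = b} =
      bernoulliMeasure true false (q e) {b} := by
    have := (measurePreserving_eval_infinitePi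
      (μ := fun i => bernoulliMeasure true false (q i)) e).measure_preimage
      (MeasurableSet.singleton b).nullMeasurableSet
    exact this
  rw [measureReal_def, h3, h4, ENNReal.toReal_mul]
  rfl

theorem bernoulliProduct_real_eq_sections [DecidableEq ι] {F : Finset ι} {e : ι} (he : e ∉ F)
    {A : Set (ι → Bool)} (hA : DependsOn (· ∈ A) (insert e F : Finset ι)) :
    (bernoulliProduct q).real A =
      (1 - (q e : ℝ)) * (bernoulliProduct q).real (sectionAt A e false) +
        (q e : ℝ) * (bernoulliProduct q).real (sectionAt A e true) := by
  have hsec : ∀ b, A ∩ {ω | ω e = b} = sectionAt A e b ∩ {ω | ω e = b} := by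
    intro b
    ext ω
    refine and_congr_left fun hb => ?_
    have hb' : ω e = b := hb
    subst hb'
    change _ ↔ Function.update ω e (ω e) ∈ A
    rw [Function.update_eq_self]
  have hcompl : A \ {ω | ω e = true} = A ∩ {ω | ω e = false} := by
    ext ω; simp
  have hm : MeasurableSet {ω : ι → Bool | ω e = true} :=
    (measurableSet_singleton true).preimage (measurable_pi_apply e)
  rw [← measureReal_inter_add_sdiff (s := A) hm, hcompl, hsec, hsec,
    bernoulliProduct_real_inter_coord q he (dependsOn_sectionAt hA _),
    bernoulliProduct_real_inter_coord q he (dependsOn_sectionAt hA _)]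
  have h1 : (bernoulliMeasure true false (q e)).real {true} = q e := by
    rw [bernoulliMeasure_real_apply_of_mem_of_notMem] <;> simp
  have h2 : (bernoulliMeasure true false (q e)).real {false} = 1 - q e := by
    rw [bernoulliMeasure_real_apply_of_notMem_of_mem] <;> simp
  rw [h1, h2]
  ring

/-- The van den Berg–Kesten inequality for increasing events of finitely many coordinates. -/
theorem bernoulliProduct_real_disjointOccurrence_le (F : Finset ι) {A B : Set (ι → Bool)}
    (hA : IsUpperSet A) (hB : IsUpperSet B)
    (hAF : DependsOn (· ∈ A) (F : Set ι)) (hBF : DependsOn (· ∈ B) (F : Set ι)) :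
    (bernoulliProduct q).real (disjointOccurrence A B) ≤
      (bernoulliProduct q).real A * (bernoulliProduct q).real B := by
  classical
  induction F using Finset.induction_on generalizing A B with
  | empty =>
    have triv : ∀ C : Set (ι → Bool), DependsOn (· ∈ C) ((∅ : Finset ι) : Set ι) →
        C = ∅ ∨ C = Set.univ := by
      intro C hC
      rcases C.eq_empty_or_nonempty with h | ⟨x, hx⟩
      · exact Or.inl h
      · exact Or.inr (Set.eq_univ_of_forall fun y =>
          (iff_of_eq (hC (x := x) (y := y) (by simp))).1 hx)
    rcases triv A hAF with rfl | rfl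
    · have : disjointOccurrence (∅ : Set (ι → Bool)) B = ∅ := by
        ext; simp [disjointOccurrence]
      simp [this]
    · rw [probReal_univ, one_mul]
      -- An increasing event contains every configuration above one of its witnesses.
      refine measureReal_mono ?_
      rintro ω ⟨a, -, b, hb, -, -, h⟩
      exact hB h hb
  | insert e F he ih =>
    set P := (bernoulliProduct q).real with hP
    rw [hP, bernoulliProduct_real_eq_sections q he hAF, bernoulliProduct_real_eq_sections q he hBF,
      bernoulliProduct_real_eq_sections q he (dependsOn_disjointOccurrence hAF hBF), ← hP]
    have ih' : ∀ b c, P (disjointOccurrence (sectionAt A e b) (sectionAt B e c)) ≤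
        P (sectionAt A e b) * P (sectionAt B e c) := fun b c =>
      ih (isUpperSet_sectionAt hA e b) (isUpperSet_sectionAt hB e c)
        (dependsOn_sectionAt hAF b) (dependsOn_sectionAt hBF c)
    have h00 := sectionAt_false_disjointOccurrence_subset A B e
    have h1 := sectionAt_true_disjointOccurrence_subset hA hB e
    have hA01 := sectionAt_false_subset hA e
    have hB01 := sectionAt_false_subset hB e
    set D0 := sectionAt (disjointOccurrence A B) e false
    set D1 := sectionAt (disjointOccurrence A B) e true
    set X := disjointOccurrence (sectionAt A e true) (sectionAt B e false) with hX
    set Y := disjointOccurrence (sectionAt A e false) (sectionAt B e true) with hY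
    have hYm : MeasurableSet Y := measurableSet_of_dependsOn
      (dependsOn_disjointOccurrence (dependsOn_sectionAt hAF _) (dependsOn_sectionAt hBF _))
    have e0 : P D0 ≤ P (sectionAt A e false) * P (sectionAt B e false) :=
      (measureReal_mono h00).trans (ih' _ _)
    have e1 : P D1 ≤ P (sectionAt A e true) * P (sectionAt B e true) := by
      refine (measureReal_mono (h1.trans (Set.union_subset ?_ ?_))).trans (ih' _ _)
      · exact disjointOccurrence_mono subset_rfl hB01
      · exact disjointOccurrence_mono hA01 subset_rfl
    -- Inclusion–exclusion: D1 lies in X ∪ Y and D0 in X ∩ Y, so P D0 + P D1 ≤ P X + P Y.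
    have e2 : P D0 + P D1 ≤ P (sectionAt A e true) * P (sectionAt B e false) +
        P (sectionAt A e false) * P (sectionAt B e true) := by
      have hu : P (X ∪ Y) + P (X ∩ Y) = P X + P Y := measureReal_union_add_inter hYm
      have hi : P D0 ≤ P (X ∩ Y) := measureReal_mono (h00.trans (Set.subset_inter
        (disjointOccurrence_mono hA01 subset_rfl) (disjointOccurrence_mono subset_rfl hB01)))
      have hj : P D1 ≤ P (X ∪ Y) := measureReal_mono h1
      linarith [ih' true false, ih' false true]
    have hq0 : 0 ≤ (q e : ℝ) := (q e).2.1
    have hq1 : 0 ≤ 1 - (q e : ℝ) := sub_nonneg.2 (q e).2.2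
    -- The weights (1 - q)², q² and q(1 - q) are those in the expanded product of the two
    -- conditioned probabilities; on the left they add up to (1 - q) P D0 + q P D1.
    have f0 := mul_le_mul_of_nonneg_left e0 (mul_nonneg hq1 hq1)
    have f1 := mul_le_mul_of_nonneg_left e1 (mul_nonneg hq0 hq0)
    have f2 := mul_le_mul_of_nonneg_left e2 (mul_nonneg hq0 hq1)
    linarith

theorem bernoulliProduct_real_disjointPower_le (F : Finset ι) {A : Set (ι → Bool)}
    (hA : IsUpperSet A) (hAF : DependsOn (· ∈ A) (F : Set ι)) (k : ℕ) :
    (bernoulliProduct q).real (disjointPower A k) ≤ (bernoulliProduct q).real A ^ k := by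
  induction k with
  | zero => simp
  | succ k ih =>
    calc (bernoulliProduct q).real (disjointPower A (k + 1))
        ≤ (bernoulliProduct q).real (disjointOccurrence A (disjointPower A k)) :=
          measureReal_mono (disjointPower_succ_subset A k)
      _ ≤ (bernoulliProduct q).real A * (bernoulliProduct q).real (disjointPower A k) :=
          bernoulliProduct_real_disjointOccurrence_le q F hA (isUpperSet_disjointPower A k) hAF
            (dependsOn_disjointPower hAF k)
      _ ≤ (bernoulliProduct q).real A ^ (k + 1) := by
          rw [pow_succ']
          exact mul_le_mul_of_nonneg_left ih measureReal_nonneg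

end BernoulliProduct

/-! ### Tail bounds from submultiplicativity -/

section TailBounds

variable {Ω : Type*} [MeasurableSpace Ω] {μ : Measure Ω} [IsProbabilityMeasure μ] {X : Ω → ℝ}

/-- Exponential upper tail from submultiplicativity of the tail along multiples. -/
theorem measureReal_ge_mul_integral_le_exp (hX : Integrable X μ) (h0 : ∀ ω, 0 < X ω)
    (hsub : ∀ (k : ℕ) (t : ℝ), 0 < k → 0 < t →
      μ.real {ω | 3 * k * t ≤ X ω} ≤ μ.real {ω | t ≤ X ω} ^ k) (α : ℝ) (hα : 0 ≤ α) :
    μ.real {ω | α * ∫ ω', X ω' ∂μ ≤ X ω} ≤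
      Real.exp 1 * Real.exp (-(1 / (3 * Real.exp 1)) * α) := by
  have hI : 0 < ∫ ω, X ω ∂μ := by
    rw [integral_pos_iff_support_of_nonneg (fun ω => (h0 ω).le) hX]
    have : Function.support X = Set.univ := Set.eq_univ_of_forall fun ω => (h0 ω).ne'
    simp [this]
  set I := ∫ ω, X ω ∂μ
  have he := Real.exp_pos 1
  have hM : μ.real {ω | Real.exp 1 * I ≤ X ω} ≤ Real.exp (-1) := by
    have := mul_meas_ge_le_integral_of_nonneg (Filter.Eventually.of_forall fun ω => (h0 ω).le) hX
      (Real.exp 1 * I)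
    rw [Real.exp_neg, ← one_div, le_div_iff₀ he]
    nlinarith
  -- For α < 3e the claimed bound is at least 1.
  rcases Nat.eq_zero_or_pos ⌊α / (3 * Real.exp 1)⌋₊ with hk | hk
  · refine measureReal_le_one.trans ?_
    rw [← Real.exp_add]
    refine Real.one_le_exp ?_
    have := Nat.floor_eq_zero.1 hk
    have h2 : 1 / (3 * Real.exp 1) * α = α / (3 * Real.exp 1) := by ring
    linarith
  · set k := ⌊α / (3 * Real.exp 1)⌋₊
    have hkle : (k : ℝ) ≤ α / (3 * Real.exp 1) := Nat.floor_le (by positivity)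
    -- Rounding down costs at most one factor e, which is the prefactor of the bound.
    have hklt : α / (3 * Real.exp 1) < k + 1 := Nat.lt_floor_add_one _
    calc μ.real {ω | α * I ≤ X ω} ≤ μ.real {ω | 3 * k * (Real.exp 1 * I) ≤ X ω} := by
          refine measureReal_mono fun ω hω => le_trans ?_ (Set.mem_ofPred_eq ▸ hω)
          rw [le_div_iff₀ (by positivity)] at hkle
          nlinarith
      _ ≤ μ.real {ω | Real.exp 1 * I ≤ X ω} ^ k := hsub k _ hk (by positivity)
      _ ≤ Real.exp (-1) ^ k := pow_le_pow_left₀ measureReal_nonneg hM k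
      _ = Real.exp (-k) := by rw [← Real.exp_nat_mul]; ring_nf
      _ ≤ Real.exp 1 * Real.exp (-(1 / (3 * Real.exp 1)) * α) := by
          rw [← Real.exp_add]
          refine Real.exp_le_exp.2 ?_
          have h2 : 1 / (3 * Real.exp 1) * α = α / (3 * Real.exp 1) := by ring
          linarith

/-- Linear lower tail from submultiplicativity of the tail along multiples. -/
theorem measureReal_lt_mul_integral_le (hX : Measurable X) (h0 : ∀ ω, 0 < X ω) {M : ℝ}
    (hM : ∀ ω, X ω ≤ M)
    (hsub : ∀ (k : ℕ) (t : ℝ), 0 < k → 0 < t →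
      μ.real {ω | 3 * k * t ≤ X ω} ≤ μ.real {ω | t ≤ X ω} ^ k) (ε : ℝ) (hε : 0 < ε) :
    μ.real {ω | X ω < ε * ∫ ω', X ω' ∂μ} ≤ 3 * ε := by
  have hXi : Integrable X μ := Integrable.of_bound hX.aestronglyMeasurable M
    (Filter.Eventually.of_forall fun ω => by
      rw [Real.norm_of_nonneg (h0 ω).le]; exact hM ω)
  have hI : 0 < ∫ ω, X ω ∂μ := by
    rw [integral_pos_iff_support_of_nonneg (fun ω => (h0 ω).le) hXi]
    have : Function.support X = Set.univ := Set.eq_univ_of_forall fun ω => (h0 ω).ne'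
    simp [this]
  set I := ∫ ω, X ω ∂μ with hIdef
  set t := ε * I
  have ht : 0 < t := by positivity
  set Q := μ.real {ω | X ω < t}
  have hge : μ.real {ω | t ≤ X ω} = 1 - Q := by
    rw [← probReal_compl_eq_one_sub (measurableSet_lt hX measurable_const)]
    congr 1; ext ω; simp
  have hQ0 : 0 ≤ Q := measureReal_nonneg
  have hQ1 : Q ≤ 1 := measureReal_le_one
  -- Boundedness of X makes the layer sum finite: X is at most 3t times the number of k ≥ 0 with 3kt
  -- ≤ X, and all such k are below n.
  obtain ⟨n, hn⟩ := exists_nat_gt (M / (3 * t))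
  have hpt : ∀ ω, X ω ≤ ∑ k ∈ Finset.range n,
      {ω | 3 * k * t ≤ X ω}.indicator (fun _ => 3 * t) ω := by
    intro ω
    have hj : ⌊X ω / (3 * t)⌋₊ + 1 ≤ n := by
      refine Nat.succ_le_of_lt ((Nat.floor_lt (by have := h0 ω; positivity)).2 (lt_of_le_of_lt ?_ hn))
      exact div_le_div_of_nonneg_right (hM ω) (by positivity)
    have hle := Nat.floor_le (show 0 ≤ X ω / (3 * t) by have := h0 ω; positivity)
    have hlt := Nat.lt_floor_add_one (X ω / (3 * t))
    set j := ⌊X ω / (3 * t)⌋₊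
    rw [div_lt_iff₀ (by positivity)] at hlt
    rw [le_div_iff₀ (by positivity)] at hle
    calc X ω ≤ ∑ k ∈ Finset.range (j + 1), 3 * t := by
          simp only [Finset.sum_const, Finset.card_range, nsmul_eq_mul]
          push_cast
          exact hlt.le
      _ = ∑ k ∈ Finset.range (j + 1), {ω | 3 * k * t ≤ X ω}.indicator (fun _ => 3 * t) ω := by
          refine Finset.sum_congr rfl fun k hk => ?_
          rw [Set.indicator_of_mem]
          have hk' : (k : ℝ) ≤ j := by exact_mod_cast Nat.lt_succ_iff.1 (Finset.mem_range.1 hk)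
          change 3 * k * t ≤ X ω
          nlinarith
      _ ≤ _ := Finset.sum_le_sum_of_subset_of_nonneg (Finset.range_subset_range.2 hj)
          fun k _ _ => Set.indicator_nonneg (fun _ _ => by positivity) _
  have hmeas : ∀ k : ℕ, MeasurableSet {ω | 3 * k * t ≤ X ω} := fun k =>
    measurableSet_le measurable_const hX
  have hint : I ≤ ∑ k ∈ Finset.range n, 3 * t * (1 - Q) ^ k := by
    calc I ≤ ∫ ω, ∑ k ∈ Finset.range n,
          {ω | 3 * k * t ≤ X ω}.indicator (fun _ => 3 * t) ω ∂μ :=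
          integral_mono hXi (integrable_finsetSum _ fun k _ =>
            (integrable_const _).indicator (hmeas k)) hpt
      _ = ∑ k ∈ Finset.range n, 3 * t * μ.real {ω | 3 * k * t ≤ X ω} := by
          rw [integral_finsetSum _ fun k _ => (integrable_const _).indicator (hmeas k)]
          refine Finset.sum_congr rfl fun k _ => ?_
          rw [integral_indicator_const _ (hmeas k), smul_eq_mul, mul_comm]
      _ ≤ _ := by
          refine Finset.sum_le_sum fun k _ => mul_le_mul_of_nonneg_left ?_ (by positivity)
          -- The layer k = 0 is not covered by `hsub`, but there the bound is 1.
          rcases Nat.eq_zero_or_pos k with rfl | hk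
          · simp
          · rw [← hge]; exact hsub k t hk ht
  have hgeom : Q * ∑ k ∈ Finset.range n, (1 - Q) ^ k ≤ 1 := by
    have := mul_neg_geom_sum (1 - Q) n
    have h2 : 0 ≤ (1 - Q) ^ n := pow_nonneg (by linarith) n
    rw [show 1 - (1 - Q) = Q by ring] at this
    linarith
  rw [← Finset.mul_sum] at hint
  have h3 : Q * I ≤ 3 * ε * I :=
    calc Q * I ≤ Q * (3 * t * ∑ k ∈ Finset.range n, (1 - Q) ^ k) :=
          mul_le_mul_of_nonneg_left hint hQ0
      _ = 3 * t * (Q * ∑ k ∈ Finset.range n, (1 - Q) ^ k) := by ring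
      _ ≤ 3 * t * 1 := mul_le_mul_of_nonneg_left hgeom (by positivity)
      _ = 3 * ε * I := by ring
  exact le_of_mul_le_mul_right h3 hI

end TailBounds

/-! ### Comparison of norms of partitions -/

namespace Finpartition

variable {V : Type*} [DecidableEq V] {Λ : Finset V}

theorem sum_card_mul_eq_sum_part (P : Finpartition Λ) (f : Finset V → ℝ) :
    ∑ B ∈ P.parts, (B.card : ℝ) * f B = ∑ v ∈ Λ, f (P.part v) := by
  have h : ∑ v ∈ Λ, f (P.part v) = ∑ v ∈ P.parts.biUnion id, f (P.part v) :=
    Finset.sum_congr P.biUnion_parts.symm fun _ _ => rfl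
  rw [h, Finset.sum_biUnion P.disjoint]
  refine Finset.sum_congr rfl fun B hB => ?_
  rw [id, ← nsmul_eq_mul, ← Finset.sum_const]
  exact Finset.sum_congr rfl fun v hv => by rw [P.part_eq_of_mem hB hv]

/-- For finite p, the sum of |B|^p over parts is the sum over vertices v of |part of v|^(p-1), and
this is monotone in the parts because p ≥ 1. -/
theorem lpNorm_mono {P Q : Finpartition Λ} (h : ∀ v ∈ Λ, P.part v ⊆ Q.part v) {p : ℝ≥0∞}
    (hp : 1 ≤ p) : P.lpNorm p ≤ Q.lpNorm p := by
  unfold lpNorm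
  split_ifs with htop
  · refine Nat.cast_le.2 (Finset.sup_le fun B hB => ?_)
    obtain ⟨v, hv⟩ := P.nonempty_of_mem_parts hB
    have hvΛ : v ∈ Λ := P.le hB hv
    rw [← P.part_eq_of_mem hB hv]
    exact (Finset.card_le_card (h v hvΛ)).trans
      (Finset.le_sup (f := Finset.card) (Q.part_mem.2 hvΛ))
  · have hp1 : 1 ≤ p.toReal := by
      simpa using (ENNReal.toReal_le_toReal ENNReal.one_ne_top htop).2 hp
    have key : ∀ R : Finpartition Λ, ∑ B ∈ R.parts, (B.card : ℝ) ^ p.toReal =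
        ∑ v ∈ Λ, ((R.part v).card : ℝ) ^ (p.toReal - 1) := by
      intro R
      rw [← R.sum_card_mul_eq_sum_part fun B => (B.card : ℝ) ^ (p.toReal - 1)]
      refine Finset.sum_congr rfl fun B hB => ?_
      have : (0 : ℝ) < B.card := Nat.cast_pos.2 (R.nonempty_of_mem_parts hB).card_pos
      rw [Real.rpow_sub_one this.ne']
      field_simp
    rw [key P, key Q]
    refine Real.rpow_le_rpow (Finset.sum_nonneg fun _ _ => by positivity)
      (Finset.sum_le_sum fun v hv => ?_) (by positivity)
    exact Real.rpow_le_rpow (by positivity) (Nat.cast_le.2 (Finset.card_le_card (h v hv)))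
      (by linarith)

theorem lpNorm_pos (P : Finpartition Λ) (hΛ : Λ.Nonempty) (p : ℝ≥0∞) : 0 < P.lpNorm p := by
  obtain ⟨v, hv⟩ := hΛ
  have hB := P.part_mem.2 hv
  have hc : 0 < (P.part v).card := (P.nonempty_of_mem_parts hB).card_pos
  unfold lpNorm
  split_ifs
  · exact Nat.cast_pos.2 (hc.trans_le (Finset.le_sup (f := Finset.card) hB))
  · refine Real.rpow_pos_of_pos (Finset.sum_pos' (fun _ _ => by positivity) ⟨_, hB, ?_⟩) _
    exact Real.rpow_pos_of_pos (Nat.cast_pos.2 hc) _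

/-- Injectivity ensures that no part of Q is charged twice; the remaining parts of Q only increase
its norm. -/
theorem lpNorm_le_mul_of_injOn {P Q : Finpartition Λ} {f : Finset V → Finset V}
    (hf : ∀ B ∈ P.parts, f B ∈ Q.parts) (hinj : Set.InjOn f P.parts) {K : ℝ} (hK : 0 ≤ K)
    (hcard : ∀ B ∈ P.parts, (B.card : ℝ) ≤ K * (f B).card) {p : ℝ≥0∞} (hp : 1 ≤ p) :
    P.lpNorm p ≤ K * Q.lpNorm p := by
  unfold lpNorm
  split_ifs with htop
  · rcases P.parts.eq_empty_or_nonempty with h | h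
    · rw [h]; simp only [Finset.sup_empty, bot_eq_zero', Nat.cast_zero]; positivity
    · obtain ⟨B, hB, heq⟩ := Finset.exists_mem_eq_sup P.parts h Finset.card
      rw [heq]
      exact (hcard B hB).trans (mul_le_mul_of_nonneg_left
        (Nat.cast_le.2 (Finset.le_sup (f := Finset.card) (hf B hB))) hK)
  · have hp1 : 1 ≤ p.toReal := by
      simpa using (ENNReal.toReal_le_toReal ENNReal.one_ne_top htop).2 hp
    have hp0 : p.toReal ≠ 0 := by linarith
    calc (∑ B ∈ P.parts, (B.card : ℝ) ^ p.toReal) ^ (1 / p.toReal)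
        ≤ (∑ B ∈ P.parts, (K * (f B).card) ^ p.toReal) ^ (1 / p.toReal) := by
          refine Real.rpow_le_rpow (Finset.sum_nonneg fun _ _ => by positivity)
            (Finset.sum_le_sum fun B hB => ?_) (by positivity)
          exact Real.rpow_le_rpow (by positivity) (hcard B hB) (by linarith)
      _ = K * (∑ B ∈ P.parts, ((f B).card : ℝ) ^ p.toReal) ^ (1 / p.toReal) := by
          simp_rw [Real.mul_rpow hK (Nat.cast_nonneg _)]
          rw [← Finset.mul_sum, Real.mul_rpow (by positivity)
            (Finset.sum_nonneg fun _ _ => by positivity), ← Real.rpow_mul hK,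
            mul_one_div_cancel hp0, Real.rpow_one]
      _ ≤ K * (∑ B ∈ Q.parts, (B.card : ℝ) ^ p.toReal) ^ (1 / p.toReal) := by
          refine mul_le_mul_of_nonneg_left (Real.rpow_le_rpow
            (Finset.sum_nonneg fun _ _ => by positivity) ?_ (by positivity)) hK
          rw [← Finset.sum_image (f := fun B : Finset V => (B.card : ℝ) ^ p.toReal) hinj]
          exact Finset.sum_le_sum_of_subset_of_nonneg (Finset.image_subset_iff.2 hf)
            fun _ _ _ => by positivity

end Finpartition

/-! ### Paths in a set of edges -/

namespace WeightedGraph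

variable {V E : Type*} (G : WeightedGraph V E)

/-- Two vertices are joined by a path with edges in `S`. -/
def Joined (S : Set E) : V → V → Prop :=
  Relation.ReflTransGen fun x y => ∃ e ∈ S, G.ends e = s(x, y)

variable {G}

theorem Joined.mono {S T : Set E} (h : S ⊆ T) {x y : V} (hxy : G.Joined S x y) :
    G.Joined T x y :=
  Relation.ReflTransGen.mono (fun _ _ ⟨e, he, h'⟩ => ⟨e, h he, h'⟩) x y hxy

theorem Joined.refl (S : Set E) (x : V) : G.Joined S x x := Relation.ReflTransGen.refl

theorem Joined.trans {S : Set E} {x y z : V} (h : G.Joined S x y) (h' : G.Joined S y z) :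
    G.Joined S x z := Relation.ReflTransGen.trans h h'

theorem Joined.symm {S : Set E} {x y : V} (h : G.Joined S x y) : G.Joined S y x := by
  induction h with
  | refl => exact Relation.ReflTransGen.refl
  | tail _ hbc ih =>
    obtain ⟨e, he, h⟩ := hbc
    exact Relation.ReflTransGen.head ⟨e, he, h.trans Sym2.eq_swap⟩ ih

theorem Joined.edge {S : Set E} {e : E} (he : e ∈ S) {x y : V} (h : G.ends e = s(x, y)) :
    G.Joined S x y := Relation.ReflTransGen.single ⟨e, he, h⟩

theorem Joined.of_mem_ends {S : Set E} {e : E} (he : e ∈ S) {x y : V} (hx : x ∈ G.ends e)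
    (hy : y ∈ G.ends e) : G.Joined S x y := by
  obtain ⟨z, hz⟩ := Sym2.mem_iff_exists.1 hx
  rw [hz, Sym2.mem_iff] at hy
  rcases hy with rfl | rfl
  · exact Joined.refl _ _
  · exact Joined.edge he hz

theorem reachable_openSubgraph_iff (ω : E → Bool) (x y : V) :
    (G.openSubgraph ω).Reachable x y ↔ G.Joined {e | ω e = true} x y := by
  rw [SimpleGraph.reachable_iff_reflTransGen]
  constructor
  · refine fun h => Relation.ReflTransGen.mono ?_ x y h
    intro a b hab
    exact ((SimpleGraph.fromEdgeSet_adj _).1 hab).1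
  · intro h
    induction h with
    | refl => exact Relation.ReflTransGen.refl
    | @tail b c _ hbc ih =>
      by_cases hne : b = c
      · exact hne ▸ ih
      · exact ih.tail ((SimpleGraph.fromEdgeSet_adj _).2 ⟨hbc, hne⟩)

theorem Joined.exists_finset {S : Set E} {x y : V} (h : G.Joined S x y) :
    ∃ F : Finset E, (F : Set E) ⊆ S ∧ G.Joined (F : Set E) x y := by
  classical
  induction h with
  | refl => exact ⟨∅, by simp, Joined.refl _ _⟩
  | tail _ hbc ih =>
    obtain ⟨F, hF, hj⟩ := ih
    obtain ⟨e, he, hends⟩ := hbc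
    refine ⟨insert e F, ?_, (hj.mono (by simp)).trans (Joined.edge (by simp) hends)⟩
    rw [Finset.coe_insert]
    exact Set.insert_subset he hF

/-! ### Cutting a cluster into large edge-disjoint pieces -/

open Classical in
variable (G) in
/-- The vertices of `Λ` joined to `r` by a path with edges in `S`. -/
noncomputable def trace (Λ : Finset V) (S : Set E) (r : V) : Finset V :=
  Λ.filter fun v => G.Joined S r v

theorem mem_trace {Λ : Finset V} {S : Set E} {r v : V} :
    v ∈ G.trace Λ S r ↔ v ∈ Λ ∧ G.Joined S r v := by
  classical
  simp [trace]

open Classical in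
variable (G) in
/-- The edges of `S` in the cluster of `r`. -/
noncomputable def clusterEdges (S : Finset E) (r : V) : Finset E :=
  S.filter fun e => ∃ x ∈ G.ends e, G.Joined (S : Set E) r x

theorem mem_clusterEdges {S : Finset E} {r : V} {e : E} :
    e ∈ G.clusterEdges S r ↔ e ∈ S ∧ ∃ x ∈ G.ends e, G.Joined (S : Set E) r x := by
  classical
  simp [clusterEdges]

theorem clusterEdges_subset (S : Finset E) (r : V) : G.clusterEdges S r ⊆ S :=
  fun _ he => (mem_clusterEdges.1 he).1

theorem disjoint_clusterEdges {S : Finset E} {r u : V} (h : ¬ G.Joined (S : Set E) r u) :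
    Disjoint (G.clusterEdges S r) (G.clusterEdges S u) := by
  rw [Finset.disjoint_left]
  intro e her heu
  obtain ⟨he, x, hx, hrx⟩ := mem_clusterEdges.1 her
  obtain ⟨-, y, hy, huy⟩ := mem_clusterEdges.1 heu
  exact h (hrx.trans ((Joined.of_mem_ends he hx hy).trans huy.symm))

theorem Joined.clusterEdges_step {S : Finset E} {r x y : V} {e : E}
    (h : G.Joined (G.clusterEdges S r : Set E) r x) (he : e ∈ S) (hends : G.ends e = s(x, y)) :
    G.Joined (G.clusterEdges S r : Set E) r y := by
  refine h.trans (Joined.edge (e := e) ?_ hends)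
  exact Finset.mem_coe.2 (mem_clusterEdges.2 ⟨he, x, by rw [hends]; exact Sym2.mem_mk_left x y,
    h.mono (Finset.coe_subset.2 (clusterEdges_subset S r))⟩)

theorem Joined.clusterEdges {S : Finset E} {r v : V} (h : G.Joined (S : Set E) r v) :
    G.Joined (G.clusterEdges S r : Set E) r v := by
  induction h with
  | refl => exact Joined.refl _ _
  | tail _ hbc ih =>
    obtain ⟨e, he, hends⟩ := hbc
    exact ih.clusterEdges_step he hends

variable (G) in
/-- A finite edge set is cut into pieces that each connect more than `m` vertices of `Λ`, and a
residue that connects at most `m` of them to the root, such that few vertices are lost. -/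
theorem exists_cut (Λ : Finset V) {m : ℕ} (hm : 1 ≤ m) (S : Finset E) (r : V) :
    ∃ (l : List (Finset E)) (R : Finset E), (R :: l).Pairwise Disjoint ∧ (∀ T ∈ R :: l, T ⊆ S) ∧
      (∀ T ∈ l, ∃ v, G.Joined (S : Set E) r v ∧ m < (G.trace Λ (T : Set E) v).card) ∧
      (G.trace Λ (R : Set E) r).card ≤ m ∧
      (G.trace Λ (S : Set E) r).card ≤ 2 * m * l.length + (G.trace Λ (R : Set E) r).card := by
  classical
  -- Without edges the root reaches only itself; this is where m ≥ 1 enters.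
  have hempty : ∀ r, (G.trace Λ ((∅ : Finset E) : Set E) r).card ≤ m := by
    intro r
    refine le_trans (Finset.card_le_one.2 ?_) hm
    have : ∀ a ∈ G.trace Λ ((∅ : Finset E) : Set E) r, a = r := by
      intro a ha
      obtain ⟨-, h⟩ := mem_trace.1 ha
      rcases Relation.ReflTransGen.cases_head h with h | ⟨c, ⟨e, he, -⟩, -⟩
      · exact h.symm
      · simp at he
    exact fun a ha b hb => (this a ha).trans (this b hb).symm
  induction hn : S.card using Nat.strong_induction_on generalizing S r with
  | _ n ih =>
  subst hn
  by_cases hex : ∃ e ∈ S, ∃ u, G.ends e = s(r, u)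
  swap
  · refine ⟨[], ∅, by simp, by simp, by simp, hempty r, ?_⟩
    simp only [List.length_nil, mul_zero, zero_add]
    refine Finset.card_le_card fun v hv => ?_
    obtain ⟨hvΛ, h⟩ := mem_trace.1 hv
    rcases Relation.ReflTransGen.cases_head h with h | ⟨c, ⟨e, he, h⟩, -⟩
    · exact mem_trace.2 ⟨hvΛ, h ▸ Joined.refl _ _⟩
    · exact absurd ⟨e, he, c, h⟩ hex
  obtain ⟨e, heS, u, hends⟩ := hex
  set S' := S.erase e with hS'
  have hS'S : S' ⊆ S := Finset.erase_subset e S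
  have hcard : S'.card < S.card := Finset.card_erase_lt_of_mem heS
  -- If e is a loop or lies on a cycle, deleting it does not change the trace. Otherwise e is a
  -- bridge, and the cut is applied to the clusters of r and u separately.
  by_cases hru : G.Joined (S' : Set E) r u
  · obtain ⟨l, R, h1, h2, h3, h4, h5⟩ := ih _ hcard S' r rfl
    refine ⟨l, R, h1, fun T hT => (h2 T hT).trans hS'S, fun T hT => ?_, h4, le_trans ?_ h5⟩
    · obtain ⟨v, hv, hc⟩ := h3 T hT
      exact ⟨v, hv.mono (Finset.coe_subset.2 hS'S), hc⟩
    · refine Finset.card_le_card fun v hv => ?_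
      obtain ⟨hvΛ, h⟩ := mem_trace.1 hv
      refine mem_trace.2 ⟨hvΛ, ?_⟩
      clear hv hvΛ
      induction h with
      | refl => exact Joined.refl _ _
      | tail _ hbc ih =>
        obtain ⟨f, hf, hfe⟩ := hbc
        by_cases hfe' : f = e
        · subst hfe'
          rw [hends] at hfe
          rcases Sym2.eq_iff.1 hfe with ⟨-, rfl⟩ | ⟨rfl, -⟩
          · exact hru
          · exact Joined.refl _ _
        · exact ih.trans (Joined.edge (Finset.mem_coe.2 (Finset.mem_erase.2 ⟨hfe', hf⟩)) hfe)
  · have hsub : ∀ x, G.clusterEdges S' x ⊆ S' := clusterEdges_subset S'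
    obtain ⟨l₁, R₁, a1, a2, a3, a4, a5⟩ := ih _ ((Finset.card_le_card (hsub r)).trans_lt hcard)
      (G.clusterEdges S' r) r rfl
    obtain ⟨l₂, R₂, b1, b2, b3, b4, b5⟩ := ih _ ((Finset.card_le_card (hsub u)).trans_lt hcard)
      (G.clusterEdges S' u) u rfl
    have hdisj : Disjoint (G.clusterEdges S' r) (G.clusterEdges S' u) := disjoint_clusterEdges hru
    have heS' : e ∉ S' := Finset.notMem_erase e S
    have hR₁ : R₁ ⊆ S' := (a2 R₁ (by simp)).trans (hsub r)
    have hR₂ : R₂ ⊆ S' := (b2 R₂ (by simp)).trans (hsub u)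
    -- The bridge glues the two residues together. If the result connects more than m vertices it
    -- becomes a new piece and the residue restarts empty. The two old residues held at most m
    -- vertices each, hence the loss of 2m per piece.
    set R := insert e (R₁ ∪ R₂) with hR
    have hRS : R ⊆ S := Finset.insert_subset heS
      ((Finset.union_subset hR₁ hR₂).trans hS'S)
    have hreu : G.Joined (R : Set E) r u := Joined.edge (by simp [hR]) hends
    have hR₁R : (R₁ : Set E) ⊆ R := Finset.coe_subset.2 fun x hx => by simp [hR, hx]
    have hR₂R : (R₂ : Set E) ⊆ R := Finset.coe_subset.2 fun x hx => by simp [hR, hx]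
    have hpw : (R :: (l₁ ++ l₂)).Pairwise Disjoint := by
      rw [List.pairwise_cons] at a1 b1
      have ha : ∀ T ∈ l₁, T ⊆ G.clusterEdges S' r := fun T hT => a2 T (by simp [hT])
      have hb : ∀ T ∈ l₂, T ⊆ G.clusterEdges S' u := fun T hT => b2 T (by simp [hT])
      rw [List.pairwise_cons, List.pairwise_append]
      refine ⟨fun T hT => ?_, a1.2, b1.2, fun T hT T' hT' => hdisj.mono (ha T hT) (hb T' hT')⟩
      rw [hR, Finset.disjoint_insert_left, Finset.disjoint_union_left]
      rcases List.mem_append.1 hT with hT | hT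
      · exact ⟨fun h => heS' (hsub r (ha T hT h)), a1.1 T hT,
          hdisj.symm.mono (b2 R₂ (by simp)) (ha T hT)⟩
      · exact ⟨fun h => heS' (hsub u (hb T hT h)), hdisj.mono (a2 R₁ (by simp)) (hb T hT),
          b1.1 T hT⟩
    have hsubset : ∀ T ∈ R :: (l₁ ++ l₂), T ⊆ S := by
      intro T hT
      rcases List.mem_cons.1 hT with rfl | hT
      · exact hRS
      rcases List.mem_append.1 hT with hT | hT
      · exact ((a2 T (by simp [hT])).trans (hsub r)).trans hS'S
      · exact ((b2 T (by simp [hT])).trans (hsub u)).trans hS'S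
    have hbig : ∀ T ∈ l₁ ++ l₂, ∃ v, G.Joined (S : Set E) r v ∧
        m < (G.trace Λ (T : Set E) v).card := by
      intro T hT
      rcases List.mem_append.1 hT with hT | hT
      · obtain ⟨v, hv, hc⟩ := a3 T hT
        exact ⟨v, hv.mono (Finset.coe_subset.2 ((hsub r).trans hS'S)), hc⟩
      · obtain ⟨v, hv, hc⟩ := b3 T hT
        exact ⟨v, (Joined.edge (Finset.mem_coe.2 heS) hends).trans
          (hv.mono (Finset.coe_subset.2 ((hsub u).trans hS'S))), hc⟩
    have hcount : (G.trace Λ (S : Set E) r).card ≤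
        (G.trace Λ (G.clusterEdges S' r : Set E) r).card +
          (G.trace Λ (G.clusterEdges S' u : Set E) u).card := by
      refine le_trans (Finset.card_le_card fun v hv => ?_) (Finset.card_union_le _ _)
      obtain ⟨hvΛ, h⟩ := mem_trace.1 hv
      rw [Finset.mem_union, mem_trace, mem_trace, ← and_or_left]
      refine ⟨hvΛ, ?_⟩
      clear hv hvΛ
      induction h with
      | refl => exact Or.inl (Joined.refl _ _)
      | tail _ hbc ih =>
        obtain ⟨f, hf, hfe⟩ := hbc
        by_cases hfe' : f = e
        · subst hfe'
          rw [hends] at hfe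
          rcases Sym2.eq_iff.1 hfe with ⟨-, rfl⟩ | ⟨rfl, -⟩
          · exact Or.inr (Joined.refl _ _)
          · exact Or.inl (Joined.refl _ _)
        · have hf' : f ∈ S' := Finset.mem_erase.2 ⟨hfe', hf⟩
          exact ih.imp (fun h => h.clusterEdges_step hf' hfe) fun h => h.clusterEdges_step hf' hfe
    have hres : (G.trace Λ (R₁ : Set E) r).card + (G.trace Λ (R₂ : Set E) u).card ≤
        (G.trace Λ (R : Set E) r).card := by
      rw [← Finset.card_union_of_disjoint]
      · refine Finset.card_le_card (Finset.union_subset (fun v hv => ?_) fun v hv => ?_)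
        · obtain ⟨hvΛ, h⟩ := mem_trace.1 hv
          exact mem_trace.2 ⟨hvΛ, h.mono hR₁R⟩
        · obtain ⟨hvΛ, h⟩ := mem_trace.1 hv
          exact mem_trace.2 ⟨hvΛ, hreu.trans (h.mono hR₂R)⟩
      · rw [Finset.disjoint_left]
        intro v hv hv'
        exact hru (((mem_trace.1 hv).2.mono (Finset.coe_subset.2 hR₁)).trans
          ((mem_trace.1 hv').2.mono (Finset.coe_subset.2 hR₂)).symm)
    by_cases hRm : (G.trace Λ (R : Set E) r).card ≤ m
    · refine ⟨l₁ ++ l₂, R, hpw, hsubset, hbig, hRm, ?_⟩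
      rw [List.length_append, mul_add]
      omega
    · refine ⟨R :: (l₁ ++ l₂), ∅, ?_, ?_, ?_, hempty r, ?_⟩
      · exact List.pairwise_cons.2 ⟨fun T _ => Finset.disjoint_empty_left T, hpw⟩
      · intro T hT
        rcases List.mem_cons.1 hT with rfl | hT
        · exact Finset.empty_subset S
        · exact hsubset T hT
      · intro T hT
        rcases List.mem_cons.1 hT with rfl | hT
        · exact ⟨r, Joined.refl _ _, not_le.1 hRm⟩
        · exact hbig T hT
      · rw [List.length_cons, List.length_append, mul_add, mul_add]
        omega

variable (G) in
-- Cut at threshold m = ⌊a/(3k)⌋. Since 3km ≤ a ≤ 2mℓ + m for ℓ pieces, 3k ≤ 2ℓ + 1 and so ℓ ≥ k;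
-- each piece connects at least m + 1 ≥ a/(3k) vertices. Confinement to the cluster of r keeps
-- pieces of different clusters disjoint.
theorem exists_disjoint_pieces {Λ : Finset V} {r : V} (hr : r ∈ Λ) (S : Finset E) {k : ℕ}
    (hk : 0 < k) :
    ∃ T : Fin k → Finset E, Pairwise (Function.onFun Disjoint T) ∧ ∀ j,
      T j ⊆ G.clusterEdges S r ∧ ∃ v, G.Joined (S : Set E) r v ∧
        (G.trace Λ (S : Set E) r).card ≤ 3 * k * (G.trace Λ (T j : Set E) v).card ∧
          (G.trace Λ (T j : Set E) v).Nonempty := by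
  set a := (G.trace Λ (S : Set E) r).card with ha
  rcases Nat.eq_zero_or_pos (a / (3 * k)) with h0 | hpos
  -- When a < 3k, the single vertex r is already a large enough trace, so empty edge sets serve as
  -- pieces.
  · refine ⟨fun _ => ∅, fun _ _ _ => Finset.disjoint_empty_left _, fun j =>
      ⟨Finset.empty_subset _, r, Joined.refl _ _, ?_⟩⟩
    have hne : (G.trace Λ ((∅ : Finset E) : Set E) r).Nonempty :=
      ⟨r, mem_trace.2 ⟨hr, Joined.refl _ _⟩⟩
    refine ⟨?_, hne⟩
    rw [Nat.div_eq_zero_iff] at h0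
    have : a ≤ 3 * k := by omega
    exact this.trans (Nat.le_mul_of_pos_right _ hne.card_pos)
  · obtain ⟨l, R, h1, h2, h3, h4, h5⟩ := G.exists_cut Λ hpos (G.clusterEdges S r) r
    set m := a / (3 * k) with hm
    have hle : a ≤ (G.trace Λ (G.clusterEdges S r : Set E) r).card :=
      Finset.card_le_card fun v hv =>
        mem_trace.2 ⟨(mem_trace.1 hv).1, (mem_trace.1 hv).2.clusterEdges⟩
    have hma : m * (3 * k) ≤ a := Nat.div_mul_le_self a (3 * k)
    have ham : a ≤ 3 * k * (m + 1) := by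
      have := Nat.lt_mul_div_succ a (b := 3 * k) (by omega)
      exact this.le
    have hlen : k ≤ l.length := by
      have h6 : m * (3 * k) ≤ m * (2 * l.length + 1) := by
        calc m * (3 * k) ≤ 2 * m * l.length + m := by omega
          _ = m * (2 * l.length + 1) := by ring
      have := Nat.le_of_mul_le_mul_left h6 hpos
      omega
    refine ⟨fun j => l.get (j.castLE hlen), fun i j hij => ?_, fun j => ?_⟩
    · have hl := (List.pairwise_cons.1 h1).2
      rw [List.pairwise_iff_get] at hl
      rcases lt_or_gt_of_ne hij with h | h
      · exact hl _ _ (by simpa using h)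
      · exact (hl _ _ (by simpa using h)).symm
    · have hmem := l.get_mem (j.castLE hlen)
      refine ⟨h2 _ (List.mem_cons_of_mem _ hmem), ?_⟩
      obtain ⟨v, hv, hc⟩ := h3 _ hmem
      refine ⟨v, hv.mono (Finset.coe_subset.2 (clusterEdges_subset S r)), ?_,
        Finset.card_pos.1 ((Nat.zero_le _).trans_lt hc)⟩
      exact ham.trans (Nat.mul_le_mul_left _ hc)

end WeightedGraph

/-! ### The cluster norm under percolation -/

namespace WeightedGraph

variable {V E : Type*} [DecidableEq V] (G : WeightedGraph V E)

theorem mem_part_clusterPartition {ω : E → Bool} {Λ : Finset V} {v w : V} :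
    w ∈ (G.clusterPartition ω Λ).part v ↔
      v ∈ Λ ∧ w ∈ Λ ∧ G.Joined {e | ω e = true} v w := by
  rw [← reachable_openSubgraph_iff]
  let _ : DecidableRel (G.openSubgraph ω).reachableSetoid.r := Classical.decRel _
  exact Finpartition.mem_part_ofSetSetoid_iff_rel (s := (G.openSubgraph ω).reachableSetoid) Λ

theorem clusterNorm_mono (Λ : Finset V) {p : ℝ≥0∞} (hp : 1 ≤ p) :
    Monotone (G.clusterNorm Λ p) := by
  intro ω ω' h
  refine Finpartition.lpNorm_mono (fun v _ w hw => ?_) hp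
  obtain ⟨h1, h2, h3⟩ := G.mem_part_clusterPartition.1 hw
  refine G.mem_part_clusterPartition.2 ⟨h1, h2, h3.mono fun e he => ?_⟩
  exact Bool.eq_true_of_true_le ((show ω e = true from he) ▸ h e)

theorem clusterNorm_pos {Λ : Finset V} (hΛ : Λ.Nonempty) (p : ℝ≥0∞) (ω : E → Bool) :
    0 < G.clusterNorm Λ p ω := Finpartition.lpNorm_pos _ hΛ p

/-- A finite set of open edges contains `k` disjoint parts, each of which has a cluster norm
comparable to a fraction `1 / k` of the total. -/
theorem exists_disjoint_clusterNorm_le (Λ : Finset V) {p : ℝ≥0∞} (hp : 1 ≤ p) {k : ℕ}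
    (hk : 0 < k) {F : Finset E} {ω : E → Bool} (hω : ∀ e, ω e = true → e ∈ F) :
    ∃ T : Fin k → E → Bool, Pairwise (Function.onFun Disjoint T) ∧
      ∀ j, T j ≤ ω ∧ G.clusterNorm Λ p ω ≤ 3 * k * G.clusterNorm Λ p (T j) := by
  classical
  set S : Finset E := F.filter fun e => ω e = true with hS
  have hSω : (S : Set E) = {e | ω e = true} := by
    ext e
    simpa [hS] using hω e
  set P := G.clusterPartition ω Λ with hP
  have hroot : ∀ B : P.parts, ∃ r ∈ Λ, P.part r = B := by
    rintro ⟨B, hB⟩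
    obtain ⟨r, hr⟩ := P.nonempty_of_mem_parts hB
    exact ⟨r, P.le hB hr, P.part_eq_of_mem hB hr⟩
  choose r hrΛ hr using hroot
  choose T hTdisj hT using fun B : P.parts => G.exists_disjoint_pieces (hrΛ B) S hk
  have hmem : ∀ (B : P.parts) {v}, v ∈ (B : Finset V) ↔ v ∈ Λ ∧ G.Joined (S : Set E) (r B) v := by
    intro B v
    rw [← hr B, hP, mem_part_clusterPartition, hSω]
    exact and_iff_right (hrΛ B)
  have htrace : ∀ B : P.parts, G.trace Λ (S : Set E) (r B) = B := by
    intro B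
    ext v
    rw [mem_trace, hmem]
  have hroots : ∀ B B' : P.parts, B ≠ B' → ¬ G.Joined (S : Set E) (r B) (r B') := by
    intro B B' hne hj
    refine hne (Subtype.ext ?_)
    ext v
    rw [hmem, hmem]
    exact and_congr_right fun _ => ⟨fun h => hj.symm.trans h, fun h => hj.trans h⟩
  -- The j-th configuration takes the j-th piece of every cluster, so that all clusters shrink by at
  -- most a factor 3k simultaneously.
  set U : Fin k → Finset E := fun j => Finset.univ.biUnion fun B => T B j with hU
  have hUdisj : ∀ i j, i ≠ j → Disjoint (U i) (U j) := by
    intro i j hij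
    rw [hU, Finset.disjoint_biUnion_left]
    intro B _
    rw [Finset.disjoint_biUnion_right]
    intro B' _
    by_cases hB : B = B'
    · subst hB
      exact hTdisj B hij
    · exact (disjoint_clusterEdges (hroots B B' hB)).mono (hT B i).1 (hT B' j).1
  have hUS : ∀ j, (U j : Set E) ⊆ S := by
    intro j
    rw [Finset.coe_subset, hU, Finset.biUnion_subset]
    exact fun B _ => (hT B j).1.trans (clusterEdges_subset _ _)
  refine ⟨fun j e => decide (e ∈ U j), fun i j hij => ?_, fun j => ⟨fun e => ?_, ?_⟩⟩
  · refine Pi.disjoint_iff.2 fun e => ?_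
    beta_reduce
    by_cases h : e ∈ U i
    · rw [decide_eq_false (Finset.disjoint_left.1 (hUdisj i j hij) h)]
      exact disjoint_bot_right
    · rw [decide_eq_false h]
      exact disjoint_bot_left
  · by_cases h : e ∈ U j
    · have : ω e = true := hSω.subset (hUS j h)
      simp [this]
    · simp [h]
  · have hset : {e | decide (e ∈ U j) = true} = (U j : Set E) := by ext; simp
    have hpart : ∀ B : P.parts, ∃ D ∈ (G.clusterPartition (fun e => decide (e ∈ U j)) Λ).parts,
        (B : Finset V).card ≤ 3 * k * D.card ∧ D ⊆ B := by
      intro B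
      -- The base point v of the piece need not lie in Λ, so the part is taken at a vertex w of its
      -- trace.
      obtain ⟨-, v, hv, hcard, w, hw⟩ := hT B j
      obtain ⟨hwΛ, hvw⟩ := mem_trace.1 hw
      have hTU : (T B j : Set E) ⊆ U j := Finset.coe_subset.2
        (Finset.subset_biUnion_of_mem (fun B => T B j) (Finset.mem_univ B))
      refine ⟨_, (Finpartition.part_mem _).2 hwΛ, ?_, fun x hx => ?_⟩
      · rw [htrace] at hcard
        refine hcard.trans (Nat.mul_le_mul_left _ (Finset.card_le_card fun x hx => ?_))
        obtain ⟨hxΛ, hvx⟩ := mem_trace.1 hx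
        rw [mem_part_clusterPartition, hset]
        exact ⟨hwΛ, hxΛ, (hvw.symm.trans hvx).mono hTU⟩
      · rw [mem_part_clusterPartition, hset] at hx
        exact (hmem B).2 ⟨hx.2.1,
          (hv.trans (hvw.mono (hTU.trans (hUS j)))).trans (hx.2.2.mono (hUS j))⟩
    choose D hD hDcard hDsub using hpart
    refine Finpartition.lpNorm_le_mul_of_injOn
      (f := fun B => if h : B ∈ P.parts then D ⟨B, h⟩ else ∅) (fun B hB => ?_) ?_ (by positivity)
      (fun B hB => ?_) hp
    · rw [dif_pos hB]
      exact hD _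
    · intro B hB B' hB' heq
      have hB := Finset.mem_coe.1 hB
      have hB' := Finset.mem_coe.1 hB'
      beta_reduce at heq
      rw [dif_pos hB, dif_pos hB'] at heq
      obtain ⟨x, hx⟩ := Finpartition.nonempty_of_mem_parts _ (hD ⟨B, hB⟩)
      -- The chosen parts are non-empty and lie inside their own clusters, so distinct clusters give
      -- distinct parts.
      exact P.eq_of_mem_parts hB hB' (hDsub _ hx) (hDsub _ (heq ▸ hx))
    · rw [dif_pos hB]
      exact_mod_cast hDcard ⟨B, hB⟩

/-- One finite open path for each connected pair of vertices of Λ already produces the whole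
partition. This reduces the norm to finitely many edges. -/
theorem exists_clusterNorm_restrictConfig_ge (Λ : Finset V) {p : ℝ≥0∞} (hp : 1 ≤ p)
    (ω : E → Bool) : ∃ F : Finset E,
      G.clusterNorm Λ p ω ≤ G.clusterNorm Λ p (restrictConfig F ω) := by
  classical
  have h : ∀ x : V × V, ∃ F : Finset E, G.Joined {e | ω e = true} x.1 x.2 →
      (F : Set E) ⊆ {e | ω e = true} ∧ G.Joined (F : Set E) x.1 x.2 := by
    intro x
    by_cases hx : G.Joined {e | ω e = true} x.1 x.2
    · obtain ⟨F, hF⟩ := hx.exists_finset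
      exact ⟨F, fun _ => hF⟩
    · exact ⟨∅, fun h => absurd h hx⟩
  choose F hF using h
  refine ⟨(Λ ×ˢ Λ).biUnion F, Finpartition.lpNorm_mono (fun v _ w hw => ?_) hp⟩
  obtain ⟨hv, hw, hj⟩ := G.mem_part_clusterPartition.1 hw
  obtain ⟨hsub, hj'⟩ := hF (v, w) hj
  refine G.mem_part_clusterPartition.2 ⟨hv, hw, hj'.mono fun e he => ?_⟩
  have hmem : e ∈ (Λ ×ˢ Λ).biUnion F :=
    Finset.mem_biUnion.2 ⟨(v, w), Finset.mk_mem_product hv hw, he⟩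
  change restrictConfig _ ω e = true
  rw [restrictConfig, if_pos hmem]
  exact hsub he

/-- The event that the cluster norm of the open edges in `F` is at least `t`. -/
def normGe (Λ : Finset V) (p : ℝ≥0∞) (t : ℝ) (F : Finset E) : Set (E → Bool) :=
  {ω | t ≤ G.clusterNorm Λ p (restrictConfig F ω)}

theorem dependsOn_normGe (Λ : Finset V) (p : ℝ≥0∞) (t : ℝ) (F : Finset E) :
    DependsOn (· ∈ G.normGe Λ p t F) (F : Set E) := by
  intro x y hxy
  have : restrictConfig F x = restrictConfig F y := by
    ext e
    by_cases he : e ∈ F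
    · simp [restrictConfig, he, hxy e he]
    · simp [restrictConfig, he]
  simp only [normGe, Set.mem_ofPred_eq, this]

theorem restrictConfig_mono {F F' : Finset E} {ω ω' : E → Bool} (hF : F ⊆ F') (hω : ω ≤ ω') :
    restrictConfig F ω ≤ restrictConfig F' ω' := by
  intro e
  by_cases he : e ∈ F
  · simpa [restrictConfig, he, hF he] using hω e
  · simp [restrictConfig, he]

theorem isUpperSet_normGe (Λ : Finset V) {p : ℝ≥0∞} (hp : 1 ≤ p) (t : ℝ) (F : Finset E) :
    IsUpperSet (G.normGe Λ p t F) := fun _ _ h hx =>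
  le_trans hx (G.clusterNorm_mono Λ hp (restrictConfig_mono subset_rfl h))

theorem iUnion_normGe (Λ : Finset V) {p : ℝ≥0∞} (hp : 1 ≤ p) (t : ℝ) :
    ⋃ F, G.normGe Λ p t F = {ω | t ≤ G.clusterNorm Λ p ω} := by
  ext ω
  rw [Set.mem_iUnion]
  constructor
  · rintro ⟨F, hF⟩
    exact le_trans hF (G.clusterNorm_mono Λ hp (restrictConfig_le F ω))
  · intro h
    obtain ⟨F, hF⟩ := G.exists_clusterNorm_restrictConfig_ge Λ hp ω
    exact ⟨F, le_trans h hF⟩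

/-- Each upper level set is a countable union of cylinder events, one for each finite edge set. -/
theorem measurable_clusterNorm [Countable E] (Λ : Finset V) {p : ℝ≥0∞} (hp : 1 ≤ p) :
    Measurable (G.clusterNorm Λ p) := by
  refine measurable_of_Ici fun t => ?_
  change MeasurableSet {ω | t ≤ G.clusterNorm Λ p ω}
  rw [← G.iUnion_normGe Λ hp t]
  exact MeasurableSet.iUnion fun F => measurableSet_of_dependsOn (G.dependsOn_normGe Λ p t F)

theorem normGe_subset_disjointPower (Λ : Finset V) {p : ℝ≥0∞} (hp : 1 ≤ p) {k : ℕ} (hk : 0 < k)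
    (t : ℝ) (F : Finset E) :
    G.normGe Λ p (3 * k * t) F ⊆ disjointPower (G.normGe Λ p t F) k := by
  intro ω hω
  obtain ⟨T, hT, h⟩ := G.exists_disjoint_clusterNorm_le Λ hp hk (F := F)
    (ω := restrictConfig F ω) fun e he => by
      by_contra hne
      simp [restrictConfig, hne] at he
  refine ⟨T, hT, fun j => ⟨?_, (h j).1.trans (restrictConfig_le F ω)⟩⟩
  have hres : restrictConfig F (T j) = T j := by
    ext e
    by_cases he : e ∈ F
    · simp [restrictConfig, he]
    · have := (h j).1 e
      simp only [restrictConfig, he, if_false] at this ⊢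
      exact (Bool.eq_false_of_le_false this).symm
  change t ≤ G.clusterNorm Λ p (restrictConfig F (T j))
  rw [hres]
  have hk' : (0 : ℝ) < 3 * k := by positivity
  exact le_of_mul_le_mul_left (le_trans hω (h j).2) hk'

theorem percolation_real_clusterNorm_ge_le_pow [Countable E] (Λ : Finset V) {p : ℝ≥0∞}
    (hp : 1 ≤ p) (β : ℝ≥0) {k : ℕ} (hk : 0 < k) (t : ℝ) :
    (G.percolation β).real {ω | 3 * k * t ≤ G.clusterNorm Λ p ω} ≤
      (G.percolation β).real {ω | t ≤ G.clusterNorm Λ p ω} ^ k := by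
  have : IsProbabilityMeasure (G.percolation β) := by unfold percolation; infer_instance
  -- The finite-volume events increase with F, so a bound uniform in F passes to their union.
  have hdir : Directed (· ⊆ ·) (G.normGe Λ p (3 * k * t)) := by
    classical
    refine directed_of_isDirected_le fun F F' h ω hω => ?_
    exact le_trans hω (G.clusterNorm_mono Λ hp (restrictConfig_mono h le_rfl))
  have hF : ∀ F, (G.percolation β) (G.normGe Λ p (3 * k * t) F) ≤
      ENNReal.ofReal ((G.percolation β).real {ω | t ≤ G.clusterNorm Λ p ω} ^ k) := by
    intro F
    rw [← ofReal_measureReal]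
    refine ENNReal.ofReal_le_ofReal ?_
    calc (G.percolation β).real (G.normGe Λ p (3 * k * t) F)
        ≤ (G.percolation β).real (disjointPower (G.normGe Λ p t F) k) :=
          measureReal_mono (G.normGe_subset_disjointPower Λ hp hk t F)
      _ ≤ (G.percolation β).real (G.normGe Λ p t F) ^ k :=
          bernoulliProduct_real_disjointPower_le (G.openProb β) F (G.isUpperSet_normGe Λ hp t F)
            (G.dependsOn_normGe Λ p t F) k
      _ ≤ _ := pow_le_pow_left₀ measureReal_nonneg (measureReal_mono
          ((Set.subset_iUnion _ F).trans (G.iUnion_normGe Λ hp t).subset)) k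
  rw [← G.iUnion_normGe Λ hp (3 * k * t), measureReal_def, hdir.measure_iUnion]
  exact ENNReal.toReal_le_of_le_ofReal (pow_nonneg measureReal_nonneg k) (iSup_le hF)

end WeightedGraph

/-! ### The two tail bounds -/

theorem theorem3p2 :
    ∃ c A : ℝ, 0 < c ∧ 0 < A ∧
      ∀ (V E : Type*) [Countable V] [Countable E] [DecidableEq V] (G : WeightedGraph V E)
        (Λ : Finset V), Λ.Nonempty → ∀ p : ℝ≥0∞, 1 ≤ p → ∀ β : ℝ≥0,
          Integrable (G.clusterNorm Λ p) (G.percolation β) ∧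
          (∀ α : ℝ, 1 ≤ α →
            (G.percolation β).real
                {ω | α * ∫ ω', G.clusterNorm Λ p ω' ∂(G.percolation β) ≤ G.clusterNorm Λ p ω}
              ≤ A * Real.exp (-c * α)) ∧
          (∀ ε : ℝ, 0 < ε → ε ≤ 1 →
            (G.percolation β).real
                {ω | G.clusterNorm Λ p ω < ε * ∫ ω', G.clusterNorm Λ p ω' ∂(G.percolation β)}
              ≤ A * ε) := by
  refine ⟨1 / (3 * Real.exp 1), max (Real.exp 1) 3, by positivity, by positivity, ?_⟩
  intro V E _ _ _ G Λ hΛ p hp β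
  have : IsProbabilityMeasure (G.percolation β) := by
    unfold WeightedGraph.percolation; infer_instance
  have hmeas := G.measurable_clusterNorm Λ hp
  have hpos := G.clusterNorm_pos hΛ p
  -- The configuration with all edges open maximises the norm, which gives integrability.
  have hbound : ∀ ω, G.clusterNorm Λ p ω ≤ G.clusterNorm Λ p ⊤ := fun ω =>
    G.clusterNorm_mono Λ hp le_top
  have hint : Integrable (G.clusterNorm Λ p) (G.percolation β) :=
    Integrable.of_bound hmeas.aestronglyMeasurable (G.clusterNorm Λ p ⊤)
      (Filter.Eventually.of_forall fun ω => by
        rw [Real.norm_of_nonneg (hpos ω).le]; exact hbound ω)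
  have hsub : ∀ (k : ℕ) (t : ℝ), 0 < k → 0 < t →
      (G.percolation β).real {ω | 3 * k * t ≤ G.clusterNorm Λ p ω} ≤
        (G.percolation β).real {ω | t ≤ G.clusterNorm Λ p ω} ^ k := fun k t hk _ =>
    G.percolation_real_clusterNorm_ge_le_pow Λ hp β hk t
  refine ⟨hint, fun α hα => ?_, fun ε hε _ => ?_⟩
  · exact (measureReal_ge_mul_integral_le_exp hint hpos hsub α (by linarith)).trans
      (mul_le_mul_of_nonneg_right (le_max_left _ _) (Real.exp_pos _).le)
  · exact (measureReal_lt_mul_integral_le hmeas hpos hbound hsub ε hε).trans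
      (mul_le_mul_of_nonneg_right (le_max_right _ _) hε.le)
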